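/- Let $n\ge 1$, let $M$ be a smooth manifold, and let $\vartheta\colon M\times G\to M$ be a smooth right action of a compact connected Lie group $G$ on $M$; write $\vartheta_g=\vartheta(\cdot,g)$. Let $\omega\in\Omega^{n+1}(M)$ satisfy $\vartheta_g^*\omega=\omega$ for all $g\in G$, and let $v$ be a smooth vector field on $M$ that is $G$-invariant, i.e. $(\vartheta_g)_*v=v$ for all $g\in G$, with $\mathcal{L}_v\omega=0$. Suppose that $H^n_{dR}(M)=0$. (1) If $\omega$ is closed (i.e. $(M,\omega)$ is a pre-$n$-plectic manifold), then $v$ is a Hamiltonian vector field of some $G$-invariant Hamiltonian form: there is $H\in\Omega^{n-1}(M)$ with $dH=-\iota_v\omega$ and $\vartheta_g^*H=H$ for all $g\in G$. Moreover $H$ is strictly preserved by the action, i.e. $\mathcal{L}_{v_x}H=0$ for every $x$ in the Lie algebra $\mathfrak g$ of $G$, where $v_x(m)=\frac{d}{dt}\big|_{0}\vartheta(m,\exp(tx))$. (2) In particular, if $\omega$ is a volume form, i.e. $\dim M=n+1$ and $\omega$ vanishes nowhere (so that the cohomological assumption reads $H^{\dim M-1}_{dR}(M)=0$, and $\mathcal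 L_v\omega=0$ says that $v$ is divergence-free), then the same conclusion holds: there is $H\in\Omega^{n-1}(M)$ with $dH=-\iota_v\omega$, $\vartheta_g^*H=H$ for all $g\in G$, and $\mathcal{L}_{v_x}H=0$ for all $x\in\mathfrak g$. -/

import Mathlib

open scoped Manifold ContDiff Topology

noncomputable section

namespace Multisymplectic

section Forms

variable {E : Type*} [NormedAddCommGroup E] [NormedSpace ℝ E]
  {M : Type*} [TopologicalSpace M] [ChartedSpace E M]

variable (E M) in
/-- Sections of `Λᵏ T*M`, with no smoothness condition. -/
abbrev FormField (k : ℕ) : Type _ :=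
  ∀ x : M, TangentSpace 𝓘(ℝ, E) x [⋀^Fin k]→L[ℝ] ℝ

variable (E M) in
/-- Sections of `TM`, with no smoothness condition. -/
abbrev VecField : Type _ := ∀ x : M, TangentSpace 𝓘(ℝ, E) x

/- The tangent space of `M` at a point is by definition a copy of the model space `E`. The next three
definitions only record values of forms, values of vector fields and differentials of maps with
their types in terms of `E`. -/

/-- The value of a form at a point. -/
def formAt {k : ℕ} (Ω : FormField E M k) (x : M) : E [⋀^Fin k]→L[ℝ] ℝ := Ω x

/-- The value of a vector field at a point. -/
def vecAt (v : VecField E M) (x : M) : E := v x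

/-- The differential of a map at a point. -/
def diffAt {E' : Type*} [NormedAddCommGroup E'] [NormedSpace ℝ E']
    {N : Type*} [TopologicalSpace N] [ChartedSpace E' N] (f : M → N) (x : M) : E →L[ℝ] E' :=
  mfderiv 𝓘(ℝ, E) 𝓘(ℝ, E') f x

/-- The coordinate expression of a form in the preferred chart at `x₀`: its pullback under the
inverse of that chart. It is meaningful on the target of the chart. -/
def formInChart {k : ℕ} (Ω : FormField E M k) (x₀ : M) (y : E) : E [⋀^Fin k]→L[ℝ] ℝ :=
  (formAt Ω ((extChartAt 𝓘(ℝ, E) x₀).symm y)).compContinuousLinearMap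
    (diffAt (extChartAt 𝓘(ℝ, E) x₀).symm y)

/-- A vector field on `M` in the preferred chart at `x₀`. -/
def vecInChart (v : VecField E M) (x₀ : M) : E → E :=
  VectorField.mpullback 𝓘(ℝ, E) 𝓘(ℝ, E) (extChartAt 𝓘(ℝ, E) x₀).symm v

/-- Transport of an alternating form on the model space at the image of `x` in the preferred chart
at `x` to the tangent space at `x`. -/
def formFromChart {k : ℕ} (x : M) (α : E [⋀^Fin k]→L[ℝ] ℝ) :
    TangentSpace 𝓘(ℝ, E) x [⋀^Fin k]→L[ℝ] ℝ :=
  α.compContinuousLinearMap (diffAt (E := E) (extChartAt 𝓘(ℝ, E) x) x)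

/-- The exterior derivative. -/
def extD {k : ℕ} (Ω : FormField E M k) : FormField E M (k + 1) := fun x =>
  formFromChart x (extDeriv (formInChart Ω x) (extChartAt 𝓘(ℝ, E) x x))

/-- The Lie derivative of a form on a normed space along a vector field,
`(L_v Ω)_x (w₁, …, w_k) = (D_{v(x)} Ω)_x (w₁, …, w_k) + ∑ i, Ω_x (w₁, …, Dv_x (w_i), …, w_k)`. -/
def lieDerivModel {k : ℕ} (v : E → E) (Ω : E → E [⋀^Fin k]→L[ℝ] ℝ) (x : E) :
    E [⋀^Fin k]→L[ℝ] ℝ :=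
  fderiv ℝ Ω x (v x) +
    (Ω x).fderivCompContinuousLinearMap (ContinuousLinearMap.id ℝ E) (fderiv ℝ v x)

theorem lieDerivModel_apply {k : ℕ} (v : E → E) (Ω : E → E [⋀^Fin k]→L[ℝ] ℝ) (x : E)
    (w : Fin k → E) :
    lieDerivModel v Ω x w =
      fderiv ℝ Ω x (v x) w + ∑ i, Ω x (Function.update w i (fderiv ℝ v x (w i))) := by
  simp only [lieDerivModel, ContinuousAlternatingMap.add_apply,
    ContinuousAlternatingMap.fderivCompContinuousLinearMap_apply]
  congr 1
  refine Finset.sum_congr rfl fun i _ => congrArg _ (funext fun j => ?_)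
  by_cases h : j = i
  · subst h; simp
  · simp [h]

/-- The Lie derivative of a form along a vector field, computed in charts. -/
def lieD {k : ℕ} (v : VecField E M) (Ω : FormField E M k) : FormField E M k := fun x =>
  formFromChart x
    (lieDerivModel (vecInChart v x) (formInChart Ω x) (extChartAt 𝓘(ℝ, E) x x))

/-- The contraction `ι_v Ω = Ω(v, ·, …, ·)`. -/
def contract {k : ℕ} (v : VecField E M) (Ω : FormField E M (k + 1)) : FormField E M k := fun x =>
  (formAt Ω x).curryLeft (vecAt v x)

/-- The pullback `f^* Ω` of a form under a map `f : M → M`. -/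
def pullbackForm {k : ℕ} (f : M → M) (Ω : FormField E M k) : FormField E M k := fun x =>
  (Ω (f x)).compContinuousLinearMap (mfderiv 𝓘(ℝ, E) 𝓘(ℝ, E) f x)

/-- A form is smooth if its coordinate expressions are. -/
def IsSmoothForm {k : ℕ} (Ω : FormField E M k) : Prop :=
  ∀ x₀ : M, ContDiffOn ℝ ∞ (formInChart Ω x₀) (extChartAt 𝓘(ℝ, E) x₀).target

/-- Smooth vector fields. -/
def IsSmoothVecField [IsManifold 𝓘(ℝ, E) ∞ M] (v : VecField E M) : Prop :=
  ContMDiff 𝓘(ℝ, E) 𝓘(ℝ, E).tangent ∞ (fun x => (⟨x, v x⟩ : TangentBundle 𝓘(ℝ, E) M))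

theorem formInChart_add {k : ℕ} (Ω η : FormField E M k) (x₀ : M) :
    formInChart (Ω + η) x₀ = formInChart Ω x₀ + formInChart η x₀ := rfl

theorem formInChart_smul {k : ℕ} (c : ℝ) (Ω : FormField E M k) (x₀ : M) :
    formInChart (c • Ω) x₀ = c • formInChart Ω x₀ := rfl

theorem IsSmoothForm.differentiableAt {k : ℕ} {Ω : FormField E M k} (h : IsSmoothForm Ω) (x : M) :
    DifferentiableAt ℝ (formInChart Ω x) (extChartAt 𝓘(ℝ, E) x x) :=
  ((h x).contDiffAt (extChartAt_target_mem_nhds x)).differentiableAt (by simp)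

theorem extD_add {k : ℕ} {Ω η : FormField E M k} (hΩ : IsSmoothForm Ω) (hη : IsSmoothForm η) :
    extD (Ω + η) = extD Ω + extD η := by
  funext x
  simp only [extD, formInChart_add, Pi.add_apply,
    extDeriv_add (hΩ.differentiableAt x) (hη.differentiableAt x)]
  rfl

theorem extD_smul {k : ℕ} (c : ℝ) (Ω : FormField E M k) : extD (c • Ω) = c • extD Ω := by
  funext x
  simp only [extD, formInChart_smul, Pi.smul_apply, extDeriv_smul]
  rfl

theorem isSmoothForm_zero {k : ℕ} : IsSmoothForm (0 : FormField E M k) := fun _ =>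
  contDiffOn_const (c := (0 : E [⋀^Fin k]→L[ℝ] ℝ))

theorem extD_zero {k : ℕ} : extD (0 : FormField E M k) = 0 := by
  simpa using extD_smul (0 : ℝ) (0 : FormField E M k)

variable (E M) in
/-- Closed smooth `k`-forms. -/
def closedForms (k : ℕ) : Submodule ℝ (FormField E M k) where
  carrier := {Ω | IsSmoothForm Ω ∧ extD Ω = 0}
  zero_mem' := ⟨isSmoothForm_zero, extD_zero⟩
  add_mem' {Ω η} hΩ hη :=
    ⟨fun x => (hΩ.1 x).add (hη.1 x), by rw [extD_add hΩ.1 hη.1, hΩ.2, hη.2, add_zero]⟩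
  smul_mem' c Ω hΩ := ⟨fun x => (hΩ.1 x).const_smul c, by rw [extD_smul, hΩ.2, smul_zero]⟩

variable (E M) in
/-- Exact smooth `k`-forms, i.e. smooth forms that are the exterior derivative of a smooth form;
in degree `0` only the zero form is exact. -/
def exactForms : (k : ℕ) → Submodule ℝ (FormField E M k)
  | 0 => ⊥
  | k + 1 =>
    { carrier := {Ω | IsSmoothForm Ω ∧ ∃ η : FormField E M k, IsSmoothForm η ∧ extD η = Ω}
      zero_mem' := ⟨isSmoothForm_zero, 0, isSmoothForm_zero, extD_zero⟩
      add_mem' := by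
        rintro Ω Ω' ⟨hΩ, η, hη, rfl⟩ ⟨hΩ', η', hη', rfl⟩
        exact ⟨fun x => (hΩ x).add (hΩ' x), η + η', fun x => (hη x).add (hη' x), extD_add hη hη'⟩
      smul_mem' := by
        rintro c Ω ⟨hΩ, η, hη, rfl⟩
        exact ⟨fun x => (hΩ x).const_smul c, c • η, fun x => (hη x).const_smul c, extD_smul c η⟩ }

instance closedForms.instAddCommGroup (k : ℕ) : AddCommGroup (closedForms E M k) :=
  Submodule.addCommGroup (R := ℝ) (M := FormField E M k) _

variable (E M) in
/-- De Rham cohomology in degree `k`: closed forms modulo exact forms. -/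
abbrev DeRhamCohomology (k : ℕ) : Type _ :=
  closedForms E M k ⧸ (exactForms E M k).submoduleOf (closedForms E M k)

/-- `Ω` is a pre-`n`-plectic form for `n = k + 1`: a closed smooth form of degree `n + 1`. -/
def IsPrePlectic {k : ℕ} (Ω : FormField E M (k + 2)) : Prop :=
  IsSmoothForm Ω ∧ extD Ω = 0

/-- `Ω` is a volume form: a nowhere vanishing smooth form of top degree. -/
def IsVolumeForm {m : ℕ} (Ω : FormField E M m) : Prop :=
  Module.finrank ℝ E = m ∧ IsSmoothForm Ω ∧ ∀ x, Ω x ≠ 0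

/-- `v` is a Hamiltonian vector field of the `(n-1)`-form `H` with respect to the `(n+1)`-form `Ω`,
where `n = k + 1`: both are smooth and `dH = - ι_v Ω`. -/
def IsHamiltonianVecField [IsManifold 𝓘(ℝ, E) ∞ M] {k : ℕ} (Ω : FormField E M (k + 2)) (H : FormField E M k)
    (v : VecField E M) : Prop :=
  IsSmoothForm H ∧ IsSmoothVecField v ∧ extD H = -contract v Ω

end Forms

section Actions

variable {E : Type*} [NormedAddCommGroup E] [NormedSpace ℝ E]
  {M : Type*} [TopologicalSpace M] [ChartedSpace E M]
  {F : Type*} [NormedAddCommGroup F] [NormedSpace ℝ F]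
  {G : Type*} [TopologicalSpace G] [ChartedSpace F G] [Group G]

variable (E F) in
/-- `θ : M × G → M` is a smooth right action of `G` on `M`. -/
structure IsSmoothRightAction (θ : M × G → M) : Prop where
  contMDiff : ContMDiff (𝓘(ℝ, E).prod 𝓘(ℝ, F)) 𝓘(ℝ, E) ∞ θ
  map_one : ∀ x, θ (x, 1) = x
  map_mul : ∀ x g h, θ (x, g * h) = θ (θ (x, g), h)

/-- `θ_g^* Ω = Ω` for all `g`. -/
def IsInvariantForm {k : ℕ} (θ : M × G → M) (Ω : FormField E M k) : Prop :=
  ∀ g : G, pullbackForm (fun x => θ (x, g)) Ω = Ω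

/-- `(θ_g)_* v = v` for all `g`. -/
def IsInvariantVecField (θ : M × G → M) (v : VecField E M) : Prop :=
  ∀ (g : G) (x : M),
    mfderiv 𝓘(ℝ, E) 𝓘(ℝ, E) (fun y => θ (y, g)) x (v x) = v (θ (x, g))

/-- The infinitesimal generator of a right action in the direction of an element `ξ` of the Lie
algebra, the value at `x` being the image of `ξ` under the differential at `1` of the orbit map
`g ↦ θ (x, g)`. That value lies in the tangent space at `θ (x, 1)`, and `θ (x, 1) = x`. -/
def generator (θ : M × G → M) (ξ : GroupLieAlgebra 𝓘(ℝ, F) G) : VecField E M := fun x =>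
  mfderiv 𝓘(ℝ, F) 𝓘(ℝ, E) (fun g => θ (x, g)) 1 ξ

variable (F) in
/-- The action strictly preserves `H`: the Lie derivatives of `H` along all infinitesimal generators
vanish. -/
def IsStrictlyPreserved {k : ℕ} (θ : M × G → M) (H : FormField E M k) : Prop :=
  ∀ ξ : GroupLieAlgebra 𝓘(ℝ, F) G, lieD (generator θ ξ) H = 0

end Actions

end Multisymplectic

end

/-! Cartan's formula gives `d(ι_v ω) = L_v ω - ι_v dω = 0`, so the vanishing of `H^n` provides a
smooth `η` with `dη = ι_v ω`. This `η` need not be invariant, so it is averaged: with `μ` the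
normalised Haar measure of the compact group, put `η' = ∫ θ_g^* η dμ(g)`. Since `θ_h^* θ_g^* =
θ_{hg}^*` for a right action, left invariance of `μ` makes `η'` invariant. Since `d` commutes with
pullbacks and with the integral, and `ι_v ω` is itself invariant, `dη' = ∫ θ_g^*(ι_v ω) dμ(g) = ι_v
ω`. Then `H = -η'` is an invariant Hamiltonian form.

Strict preservation is the infinitesimal version of invariance: differentiate `θ_g^* H = H` in `g`
at `1`. For a volume form, `dω` has degree larger than `dim M`, hence vanishes, and the second
statement reduces to the first.

The analytic content lies in charts. `contDiffAt_formInChart_pullbackForm` shows that the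
coefficients of `θ_g^* η` are jointly smooth in the point and in `g`; `contDiffOn_integral` and
`hasFDerivAt_integral_of_continuousOn` turn this into smoothness of the average and into the
exchange of `d` and the integral. `lieDerivModel_eq_extDeriv_add` and
`lieDerivModel_eq_zero_of_invariant` are the local forms of Cartan's formula and of strict
preservation. -/

noncomputable section

namespace Multisymplectic

open MeasureTheory Set Filter

/-! ### Alternating forms and Lie derivatives on a normed space. -/

section Model

set_option maxSynthPendingDepth 3

variable {E : Type*} [NormedAddCommGroup E] [NormedSpace ℝ E]
  {E' : Type*} [NormedAddCommGroup E'] [NormedSpace ℝ E']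
  {F : Type*} [NormedAddCommGroup F] [NormedSpace ℝ F]

variable (E) in
/-- Currying of alternating forms as a continuous linear map. -/
def curryLeftCLM (k : ℕ) :
    (E [⋀^Fin (k + 1)]→L[ℝ] ℝ) →L[ℝ] E →L[ℝ] (E [⋀^Fin k]→L[ℝ] ℝ) :=
  (ContinuousAlternatingMap.curryLeftLI (𝕜 := ℝ) (E := E) (F := ℝ)
    (n := k)).toContinuousLinearMap

@[simp]
theorem curryLeftCLM_apply {k : ℕ} (α : E [⋀^Fin (k + 1)]→L[ℝ] ℝ) :
    curryLeftCLM E k α = α.curryLeft := rfl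

/-- The pullback of alternating forms along a linear map depends smoothly on the linear map. -/
theorem contDiff_compContinuousLinearMapCLM (k : ℕ) :
    ContDiff ℝ ∞ (fun A : E →L[ℝ] E' =>
      (ContinuousAlternatingMap.compContinuousLinearMapCLM A :
        (E' [⋀^Fin k]→L[ℝ] ℝ) →L[ℝ] (E [⋀^Fin k]→L[ℝ] ℝ))) := by
  induction k with
  -- In degree `0` the pullback does not depend on `A`, as there is only one family of vectors
  -- indexed by `Fin 0`.
  | zero =>
    have : (fun A : E →L[ℝ] E' =>
      (ContinuousAlternatingMap.compContinuousLinearMapCLM A :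
        (E' [⋀^Fin 0]→L[ℝ] ℝ) →L[ℝ] (E [⋀^Fin 0]→L[ℝ] ℝ))) =
        fun _ => ContinuousAlternatingMap.compContinuousLinearMapCLM 0 := by
      funext A
      ext f w
      exact congrArg f (Subsingleton.elim _ _)
    rw [this]
    exact contDiff_const
  | succ k ih =>
    -- Alternatizing the curried form multiplies a form of degree `k + 1` by `k + 1`. Hence `A^* f`
    -- is `(k + 1)⁻¹` times the alternatization of `x ↦ A^*(f(A x, ·))`, which involves `A` only
    -- linearly and through the pullback in degree `k`.
    have key : (fun A : E →L[ℝ] E' =>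
        (ContinuousAlternatingMap.compContinuousLinearMapCLM A :
          (E' [⋀^Fin (k + 1)]→L[ℝ] ℝ) →L[ℝ] (E [⋀^Fin (k + 1)]→L[ℝ] ℝ))) =
        fun A => ((k : ℝ) + 1)⁻¹ •
          (ContinuousAlternatingMap.alternatizeUncurryFinCLM ℝ E ℝ ∘L
            (ContinuousLinearMap.compL ℝ E (E' [⋀^Fin k]→L[ℝ] ℝ) (E [⋀^Fin k]→L[ℝ] ℝ)
              (ContinuousAlternatingMap.compContinuousLinearMapCLM A)) ∘L
            ((ContinuousLinearMap.compL ℝ E E' (E' [⋀^Fin k]→L[ℝ] ℝ)).flip A) ∘L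
            curryLeftCLM E' k) := by
      funext A
      ext f w
      have h := congrArg (fun g => g w) (ContinuousAlternatingMap.alternatizeUncurryFin_curryLeft
        (f.compContinuousLinearMap A))
      simp only [ContinuousAlternatingMap.smul_apply, nsmul_eq_mul] at h
      have hk : ((k : ℝ) + 1) ≠ 0 := by positivity
      have h2 : (ContinuousAlternatingMap.alternatizeUncurryFin
          (f.compContinuousLinearMap A).curryLeft) w =
          ContinuousAlternatingMap.alternatizeUncurryFin
            ((ContinuousAlternatingMap.compContinuousLinearMapCLM A) ∘L
              (f.curryLeft ∘L A)) w := by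
        congr 2
        ext x u
        simp only [ContinuousAlternatingMap.curryLeft_apply_apply,
          ContinuousLinearMap.comp_apply,
          ContinuousAlternatingMap.compContinuousLinearMap_apply,
          ContinuousAlternatingMap.compContinuousLinearMapCLM_apply]
        congr 1
        funext i
        refine Fin.cases ?_ (fun j => ?_) i <;> simp
      rw [h2] at h
      simp only [smul_apply, ContinuousAlternatingMap.smul_apply, smul_eq_mul]
      rw [eq_inv_mul_iff_mul_eq₀ hk]
      push_cast at h
      exact h.symm
    rw [key]
    have h1 : ContDiff ℝ ∞ (fun A : E →L[ℝ] E' =>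
        ContinuousLinearMap.compL ℝ E (E' [⋀^Fin k]→L[ℝ] ℝ) (E [⋀^Fin k]→L[ℝ] ℝ)
          (ContinuousAlternatingMap.compContinuousLinearMapCLM A)) :=
      (ContinuousLinearMap.contDiff _).comp ih
    have h2 : ContDiff ℝ ∞ (fun A : E →L[ℝ] E' =>
        (ContinuousLinearMap.compL ℝ E E' (E' [⋀^Fin k]→L[ℝ] ℝ)).flip A) :=
      ContinuousLinearMap.contDiff _
    have h3 := h1.clm_comp (h2.clm_comp (contDiff_const (c := curryLeftCLM E' k)))
    have h4 := (contDiff_const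
      (c := ContinuousAlternatingMap.alternatizeUncurryFinCLM ℝ E ℝ)).clm_comp h3
    exact h4.const_smul _

theorem _root_.ContDiffAt.alternatingCompContinuousLinearMap {k : ℕ}
    {α : F → E' [⋀^Fin k]→L[ℝ] ℝ} {A : F → E →L[ℝ] E'} {x : F}
    (hα : ContDiffAt ℝ ∞ α x) (hA : ContDiffAt ℝ ∞ A x) :
    ContDiffAt ℝ ∞ (fun y => (α y).compContinuousLinearMap (A y)) x :=
  ((contDiff_compContinuousLinearMapCLM k).contDiffAt.comp x hA).clm_apply hα

/-- Cartan's formula on a normed space. -/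
theorem lieDerivModel_eq_extDeriv_add {k : ℕ} {v : E → E} {α : E → E [⋀^Fin (k + 1)]→L[ℝ] ℝ}
    {x : E} (hv : DifferentiableAt ℝ v x) (hα : DifferentiableAt ℝ α x) :
    lieDerivModel v α x =
      extDeriv (fun y => (α y).curryLeft (v y)) x + (extDeriv α x).curryLeft (v x) := by
  have hL : HasFDerivAt (fun y => (α y).curryLeft)
      (curryLeftCLM E k ∘L fderiv ℝ α x) x :=
    have h := (curryLeftCLM E k).hasFDerivAt (x := α x)
    h.comp x hα.hasFDerivAt
  have hd := (hL.clm_apply hv.hasFDerivAt).fderiv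
  -- In `dα(v, w)` the zeroth summand is the derivative of `α` along `v`. The others, by this
  -- identity, are the derivatives of `α` along `w i` with `v` in the first slot; they carry the
  -- opposite sign to the same terms in `d(ι_v α)` and cancel. What remains of `d(ι_v α)` is the
  -- part that differentiates `v`.
  have (i : Fin (k + 1)) (w : Fin (k + 1) → E) :
      i.succ.removeNth (Matrix.vecCons (v x) w) = Matrix.vecCons (v x) (i.removeNth w) := by
    funext j
    refine Fin.cases ?_ (fun j => ?_) j <;> simp [Fin.removeNth]
  ext w
  rw [extDeriv, hd, lieDerivModel,
    ContinuousAlternatingMap.fderivCompContinuousLinearMap_eq_alternatizeUncurryFin]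
  simp only [extDeriv, ContinuousAlternatingMap.add_apply,
    ContinuousAlternatingMap.curryLeft_apply_apply,
    ContinuousAlternatingMap.alternatizeUncurryFin_apply, Fin.sum_univ_succ (n := k + 1),
    ContinuousLinearMap.comp_apply, ContinuousAlternatingMap.alternatizeUncurryFinCLM_apply]
  simp [pow_succ, Finset.sum_add_distrib, this]
  ring

/-- If a form is invariant under a local family of maps `Φ (·, z)` with `Φ (·, z₀) = id`, then its
Lie derivative along the variation field of the family vanishes. -/
theorem lieDerivModel_eq_zero_of_invariant {k : ℕ} {Φ : E × F → E} {y₀ : E} {z₀ : F}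
    (hΦ : ContDiffAt ℝ ∞ Φ (y₀, z₀)) (hid : ∀ᶠ y in 𝓝 y₀, Φ (y, z₀) = y)
    {α : E → E [⋀^Fin k]→L[ℝ] ℝ} (hα : DifferentiableAt ℝ α y₀)
    (hinv : ∀ᶠ z in 𝓝 z₀,
      (α (Φ (y₀, z))).compContinuousLinearMap (fderiv ℝ (fun y => Φ (y, z)) y₀) = α y₀)
    {v : E → E} {ξ : F} (hv : ∀ᶠ y in 𝓝 y₀, v y = fderiv ℝ (fun z => Φ (y, z)) z₀ ξ) :
    lieDerivModel v α y₀ = 0 := by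
  have hfd : ∀ᶠ p in 𝓝 (y₀, z₀), DifferentiableAt ℝ Φ p :=
    ((hΦ.of_le (m := 1) (by simp)).eventually (by simp)).mono fun p hp =>
      hp.differentiableAt (by simp)
  have hD : HasFDerivAt (fderiv ℝ Φ) (fderiv ℝ (fderiv ℝ Φ) (y₀, z₀)) (y₀, z₀) :=
    ((hΦ.fderiv_right (m := 1) (by norm_cast)).differentiableAt
      (by simp)).hasFDerivAt
  set D := fderiv ℝ (fderiv ℝ Φ) (y₀, z₀)
  -- Symmetry of second derivatives is the heart of the matter: the derivative in `z` of the
  -- differential `∂_y Φ`, in the direction `ξ`, is the derivative in `y` of `∂_z Φ ξ`, that is, the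
  -- derivative of `v`.
  have hsymm : IsSymmSndFDerivAt ℝ Φ (y₀, z₀) := hΦ.isSymmSndFDerivAt (by simp; norm_cast)
  have hl : ∀ p : E × F, DifferentiableAt ℝ Φ p →
      HasFDerivAt (fun y => Φ (y, p.2)) (fderiv ℝ Φ p ∘L .inl ℝ E F) p.1 := fun p hp =>
    hp.hasFDerivAt.comp p.1 (hasFDerivAt_prodMk_left p.1 p.2)
  have hr : ∀ p : E × F, DifferentiableAt ℝ Φ p →
      HasFDerivAt (fun z => Φ (p.1, z)) (fderiv ℝ Φ p ∘L .inr ℝ E F) p.2 := fun p hp =>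
    hp.hasFDerivAt.comp p.2 (hasFDerivAt_prodMk_right p.1 p.2)
  have hcl : Tendsto (fun y => (y, z₀)) (𝓝 y₀) (𝓝 (y₀, z₀)) :=
    (Continuous.prodMk_left z₀).tendsto y₀
  have hcr : Tendsto (fun z => (y₀, z)) (𝓝 z₀) (𝓝 (y₀, z₀)) :=
    (Continuous.prodMk_right y₀).tendsto z₀
  have hid0 : Φ (y₀, z₀) = y₀ := hid.self_of_nhds
  have hidD : fderiv ℝ (fun y => Φ (y, z₀)) y₀ = .id ℝ E :=
    (EventuallyEq.fderiv_eq (f := id) hid).trans fderiv_id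
  have hdv : HasFDerivAt v ((ContinuousLinearMap.apply ℝ E ((0 : E), ξ)) ∘L D ∘L .inl ℝ E F) y₀ := by
    have h1 : HasFDerivAt (fun y => fderiv ℝ Φ (y, z₀) (0, ξ))
        ((ContinuousLinearMap.apply ℝ E ((0 : E), ξ)) ∘L D ∘L .inl ℝ E F) y₀ :=
      ((ContinuousLinearMap.apply ℝ E ((0 : E), ξ)).hasFDerivAt).comp y₀
        (hD.comp y₀ (hasFDerivAt_prodMk_left y₀ z₀))
    refine h1.congr_of_eventuallyEq ?_
    filter_upwards [hv, hcl.eventually hfd] with y hy hy'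
    rw [hy, (hr _ hy').fderiv]
    rfl
  have hA : HasFDerivAt (fun z => fderiv ℝ (fun y => Φ (y, z)) y₀)
      (((ContinuousLinearMap.compL ℝ E (E × F) E).flip (.inl ℝ E F)) ∘L D ∘L .inr ℝ E F) z₀ := by
    have h1 := (((ContinuousLinearMap.compL ℝ E (E × F) E).flip
        (.inl ℝ E F)).hasFDerivAt).comp z₀ (hD.comp z₀ (hasFDerivAt_prodMk_right y₀ z₀))
    refine h1.congr_of_eventuallyEq ?_
    filter_upwards [hcr.eventually hfd] with z hz
    exact (hl _ hz).fderiv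
  have hα' : HasFDerivAt (fun z => α (Φ (y₀, z)))
      (fderiv ℝ α y₀ ∘L fderiv ℝ Φ (y₀, z₀) ∘L .inr ℝ E F) z₀ := by
    refine HasFDerivAt.comp z₀ ?_ (hr _ hfd.self_of_nhds)
    rw [hid0]
    exact hα.hasFDerivAt
  -- The derivative at `z₀` of `z ↦ Φ(·, z)^* α` at `y₀`. By invariance this function is locally
  -- constant, so uniqueness of the derivative gives `0`; evaluated at `ξ`, the derivative is the
  -- Lie derivative.
  have h := hα'.continuousAlternatingMapCompContinuousLinearMap hA
  have h0 := h.unique ((hasFDerivAt_const (α y₀) z₀).congr_of_eventuallyEq hinv)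
  have h1 := congrArg (fun L => L ξ) h0
  have hv0 : v y₀ = fderiv ℝ Φ (y₀, z₀) (0, ξ) := by
    rw [hv.self_of_nhds, (hr _ hfd.self_of_nhds).fderiv]
    rfl
  rw [lieDerivModel, hdv.fderiv, hv0]
  rw [hidD, hid0] at h1
  have h2 : (((ContinuousLinearMap.compL ℝ E (E × F) E).flip (.inl ℝ E F)) ∘L D ∘L .inr ℝ E F) ξ
      = (ContinuousLinearMap.apply ℝ E ((0 : E), ξ)) ∘L D ∘L .inl ℝ E F := by
    ext e
    exact hsymm _ _
  rw [← h2]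
  exact h1

end Model

/-! ### Integrals over a compact space depending on a parameter. -/

section ParametricIntegral

set_option maxSynthPendingDepth 3

theorem _root_.Continuous.integrable_of_compactSpace {V X : Type*} [NormedAddCommGroup V]
    [TopologicalSpace X] [CompactSpace X] [T2Space X] [MeasurableSpace X] [BorelSpace X]
    {μ : Measure X} [IsFiniteMeasure μ] {f : X → V} (hf : Continuous f) : Integrable f μ := by
  rw [← integrableOn_univ]
  exact hf.continuousOn.integrableOn_compact isCompact_univ

theorem _root_.ContinuousOn.continuous_slice {Y X V : Type*} [TopologicalSpace Y]
    [TopologicalSpace X] [TopologicalSpace V] {f : Y × X → V} {U : Set Y}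
    (hf : ContinuousOn f (U ×ˢ univ)) {y : Y} (hy : y ∈ U) : Continuous fun g => f (y, g) := by
  rw [← continuousOn_univ]
  exact hf.comp (Continuous.prodMk_right y).continuousOn fun g _ => ⟨hy, mem_univ _⟩

/-- Supplies the constant dominating function for dominated convergence: a compact neighbourhood
times the compact space `X` is compact. -/
theorem exists_nhds_bound {Y X V : Type*} [TopologicalSpace Y] [LocallyCompactSpace Y]
    [TopologicalSpace X] [CompactSpace X] [NormedAddCommGroup V] {f : Y × X → V} {U : Set Y}
    (hU : IsOpen U) (hf : ContinuousOn f (U ×ˢ univ)) {y₀ : Y} (hy₀ : y₀ ∈ U) :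
    ∃ s ∈ 𝓝 y₀, s ⊆ U ∧ ∃ C, ∀ y ∈ s, ∀ g, ‖f (y, g)‖ ≤ C := by
  obtain ⟨s, hs, hsU, hsc⟩ := local_compact_nhds (hU.mem_nhds hy₀)
  obtain ⟨C, hC⟩ := (hsc.prod (isCompact_univ (X := X))).exists_bound_of_continuousOn
    (hf.mono (prod_mono hsU subset_rfl))
  exact ⟨s, hs, hsU, C, fun y hy g => hC _ ⟨hy, mem_univ _⟩⟩

variable {E : Type*} [NormedAddCommGroup E] [NormedSpace ℝ E] [FiniteDimensional ℝ E]
  {V : Type*} [NormedAddCommGroup V] [NormedSpace ℝ V]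
  {X : Type*} [TopologicalSpace X] [CompactSpace X] [T2Space X]
  [MeasurableSpace X] [BorelSpace X] {μ : Measure X} [IsFiniteMeasure μ]

/-- Differentiation under the integral over a compact space. -/
theorem hasFDerivAt_integral_of_continuousOn {K : E → X → V} {K' : E → X → E →L[ℝ] V} {U : Set E}
    (hU : IsOpen U) (hK : ContinuousOn (fun p : E × X => K p.1 p.2) (U ×ˢ univ))
    (hK' : ContinuousOn (fun p : E × X => K' p.1 p.2) (U ×ˢ univ))
    (hd : ∀ y ∈ U, ∀ g, HasFDerivAt (fun z => K z g) (K' y g) y) {y₀ : E} (hy₀ : y₀ ∈ U) :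
    HasFDerivAt (fun y => ∫ g, K y g ∂μ) (∫ g, K' y₀ g ∂μ) y₀ := by
  obtain ⟨s, hs, hsU, C, hC⟩ := exists_nhds_bound hU hK' hy₀
  refine hasFDerivAt_integral_of_dominated_of_fderiv_le (bound := fun _ => C) hs ?_ ?_ ?_ ?_ ?_ ?_
  · filter_upwards [hU.mem_nhds hy₀] with y hy
    exact (hK.continuous_slice hy).integrable_of_compactSpace.aestronglyMeasurable
  · exact (hK.continuous_slice hy₀).integrable_of_compactSpace
  · exact (hK'.continuous_slice hy₀).integrable_of_compactSpace.aestronglyMeasurable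
  · exact Eventually.of_forall fun g y hy => hC y hy g
  · exact integrable_const C
  · exact Eventually.of_forall fun g y hy => hd y (hsU hy) g

theorem continuousOn_integral_of_continuousOn {K : E → X → V} {U : Set E}
    (hU : IsOpen U) (hK : ContinuousOn (fun p : E × X => K p.1 p.2) (U ×ˢ univ)) :
    ContinuousOn (fun y => ∫ g, K y g ∂μ) U := by
  intro y₀ hy₀
  obtain ⟨s, hs, hsU, C, hC⟩ := exists_nhds_bound hU hK hy₀
  refine (continuousAt_of_dominated (bound := fun _ => C) ?_ ?_ (integrable_const C)
    ?_).continuousWithinAt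
  · filter_upwards [hU.mem_nhds hy₀] with y hy
    exact (hK.continuous_slice hy).integrable_of_compactSpace.aestronglyMeasurable
  · filter_upwards [hs] with y hy
    exact Eventually.of_forall fun g => hC y hy g
  · refine Eventually.of_forall fun g => ?_
    exact ((hK (y₀, g) ⟨hy₀, mem_univ _⟩).continuousAt
      ((hU.prod isOpen_univ).mem_nhds ⟨hy₀, mem_univ _⟩)).comp
        (f := fun y => (y, g)) (Continuous.prodMk_left g).continuousAt

/-- An integral over a compact space is smooth in the parameter as soon as the partial
derivatives of the integrand are jointly continuous. -/
theorem contDiffOn_integral [CompleteSpace V] {K : E → X → V} {U : Set E} (hU : IsOpen U)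
    (hsm : ∀ g, ContDiffOn ℝ ∞ (fun y => K y g) U)
    (hK : ∀ m : ℕ, ContinuousOn (fun p : E × X => iteratedFDeriv ℝ m (fun y => K y p.2) p.1)
      (U ×ˢ univ)) :
    ContDiffOn ℝ ∞ (fun y => ∫ g, K y g ∂μ) U := by
  -- The Taylor series of the integral is the integral of the Taylor series of the integrand. The
  -- linear isometries that identify multilinear maps with their curried forms pass through the
  -- integral.
  have hT : HasFTaylorSeriesUpToOn ∞ (fun y => ∫ g, K y g ∂μ)
      (fun y m => ∫ g, iteratedFDeriv ℝ m (fun z => K z g) y ∂μ) U := by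
    refine ⟨fun y hy => ?_, fun m _ y hy => ?_, fun m _ => ?_⟩
    · have := (continuousMultilinearCurryFin0 ℝ E V).toContinuousLinearEquiv.integral_comp_comm
        (μ := μ) (fun g => iteratedFDeriv ℝ 0 (fun z => K z g) y)
      exact this.symm
    · have h := hasFDerivAt_integral_of_continuousOn (μ := μ) hU
        (K := fun y g => iteratedFDeriv ℝ m (fun z => K z g) y) (hK m)
        (K' := fun y g => (iteratedFDeriv ℝ (m + 1) (fun z => K z g) y).curryLeft) ?_ ?_ hy
      · have := (continuousMultilinearCurryLeftEquiv ℝ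
          (fun _ : Fin (m + 1) => E) V).toContinuousLinearEquiv.integral_comp_comm
          (μ := μ) (fun g => iteratedFDeriv ℝ (m + 1) (fun z => K z g) y)
        exact (h.congr_fderiv this).hasFDerivWithinAt
      · exact (continuousMultilinearCurryLeftEquiv ℝ
          (fun _ : Fin (m + 1) => E) V).continuous.comp_continuousOn (hK (m + 1))
      · intro y hy g
        have h1 : ContDiffAt ℝ ∞ (fun z => K z g) y := (hsm g).contDiffAt (hU.mem_nhds hy)
        have h2 : DifferentiableAt ℝ (iteratedFDeriv ℝ m (fun z => K z g)) y :=
          h1.differentiableAt_iteratedFDeriv (by exact_mod_cast ENat.natCast_lt_top m)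
        have h3 := h2.hasFDerivAt
        rw [fderiv_iteratedFDeriv] at h3
        exact h3
    · exact continuousOn_integral_of_continuousOn hU (hK m)
  exact hT.contDiffOn

end ParametricIntegral

/-! ### Forms, pullbacks and exterior derivatives in the preferred charts. -/

section Charts

set_option maxSynthPendingDepth 3

variable {E : Type*} [NormedAddCommGroup E] [NormedSpace ℝ E]
  {M : Type*} [TopologicalSpace M] [ChartedSpace E M]
  {F : Type*} [NormedAddCommGroup F] [NormedSpace ℝ F]
  {N : Type*} [TopologicalSpace N] [ChartedSpace F N]
  {F' : Type*} [NormedAddCommGroup F'] [NormedSpace ℝ F']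
  {P : Type*} [TopologicalSpace P] [ChartedSpace F' P]

theorem diffAt_comp {g : N → P} {f : M → N} {x : M}
    (hg : MDifferentiableAt 𝓘(ℝ, F) 𝓘(ℝ, F') g (f x))
    (hf : MDifferentiableAt 𝓘(ℝ, E) 𝓘(ℝ, F) f x) :
    diffAt (E := E) (E' := F') (g ∘ f) x =
      diffAt (E := F) (E' := F') g (f x) ∘L diffAt (E := E) (E' := F) f x :=
  mfderiv_comp x hg hf

theorem diffAt_congr {f g : M → N} {x : M} (h : f =ᶠ[𝓝 x] g) :
    diffAt (E := E) (E' := F) f x = diffAt (E := E) (E' := F) g x :=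
  h.mfderiv_eq

theorem diffAt_eq_fderiv (f : E → F) (x : E) : diffAt f x = fderiv ℝ f x :=
  mfderiv_eq_fderiv

theorem diffAt_id (x : M) : diffAt (E := E) (E' := E) (id : M → M) x = .id ℝ E :=
  mfderiv_id

theorem pullbackForm_eq {k : ℕ} (f : M → M) (Ω : FormField E M k) (x : M) :
    formAt (pullbackForm f Ω) x =
      (formAt Ω (f x)).compContinuousLinearMap (diffAt (E := E) (E' := E) f x) := rfl

/-- Used to see that `ι_v Ω` is invariant when both `v` and `Ω` are. -/
theorem pullbackForm_contract {k : ℕ} {f : M → M} {v : VecField E M}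
    (hv : ∀ x, mfderiv 𝓘(ℝ, E) 𝓘(ℝ, E) f x (v x) = v (f x)) (Ω : FormField E M (k + 1)) :
    pullbackForm f (contract v Ω) = contract v (pullbackForm f Ω) := by
  funext x
  change (((formAt Ω (f x)).curryLeft (vecAt v (f x))).compContinuousLinearMap
    (diffAt (E := E) (E' := E) f x)) = ((formAt Ω (f x)).compContinuousLinearMap
    (diffAt (E := E) (E' := E) f x)).curryLeft (vecAt v x)
  have h : diffAt (E := E) (E' := E) f x (vecAt v x) = vecAt v (f x) := hv x
  ext w
  simp only [ContinuousAlternatingMap.compContinuousLinearMap_apply,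
    ContinuousAlternatingMap.curryLeft_apply_apply, ← h]
  congr 1
  funext i
  refine Fin.cases ?_ (fun j => ?_) i <;> simp

/-- Forms of degree larger than the dimension vanish. -/
theorem formField_eq_zero [FiniteDimensional ℝ E] {m : ℕ} (hm : Module.finrank ℝ E < m)
    (Ω : FormField E M m) : Ω = 0 := by
  funext x
  change formAt Ω x = 0
  ext w
  refine (formAt Ω x).toAlternatingMap.map_linearDependent w fun h => ?_
  simpa using h.fintype_card_le_finrank.trans_lt hm

/-- The expression of a map in the preferred charts at `x₀` and `x₁`. -/
def mapInCharts (f : M → N) (x₀ : M) (x₁ : N) : E → F :=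
  extChartAt 𝓘(ℝ, F) x₁ ∘ f ∘ (extChartAt 𝓘(ℝ, E) x₀).symm

variable [IsManifold 𝓘(ℝ, E) ∞ M]

theorem contMDiffAt_extChartAt_symm {x₀ : M} {y : E} (hy : y ∈ (extChartAt 𝓘(ℝ, E) x₀).target) :
    ContMDiffAt 𝓘(ℝ, E) 𝓘(ℝ, E) ∞ (extChartAt 𝓘(ℝ, E) x₀).symm y :=
  (contMDiffOn_extChartAt_symm x₀).contMDiffAt
    ((isOpen_extChartAt_target x₀).mem_nhds hy)

theorem eventually_mem_source {f : M → N} {x₀ : M} {y : E}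
    (hy : y ∈ (extChartAt 𝓘(ℝ, E) x₀).target)
    (hf : ContinuousAt f ((extChartAt 𝓘(ℝ, E) x₀).symm y))
    {x₁ : N} (h₁ : f ((extChartAt 𝓘(ℝ, E) x₀).symm y) ∈ (extChartAt 𝓘(ℝ, F) x₁).source) :
    ∀ᶠ z in 𝓝 y, z ∈ (extChartAt 𝓘(ℝ, E) x₀).target ∧
      f ((extChartAt 𝓘(ℝ, E) x₀).symm z) ∈ (extChartAt 𝓘(ℝ, F) x₁).source :=
  ((isOpen_extChartAt_target x₀).eventually_mem hy).and
    ((hf.comp (contMDiffAt_extChartAt_symm hy).continuousAt).eventually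
      ((isOpen_extChartAt_source x₁).mem_nhds h₁))

variable [IsManifold 𝓘(ℝ, F) ∞ N]

theorem contMDiffAt_extChartAt_of_mem {x₀ x : M} (hx : x ∈ (extChartAt 𝓘(ℝ, E) x₀).source) :
    ContMDiffAt 𝓘(ℝ, E) 𝓘(ℝ, E) ∞ (extChartAt 𝓘(ℝ, E) x₀) x :=
  contMDiffAt_extChartAt' (by rwa [← extChartAt_source 𝓘(ℝ, E)])

theorem diffAt_extChartAt_comp_symm {x₀ : M} {y : E}
    (hy : y ∈ (extChartAt 𝓘(ℝ, E) x₀).target) :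
    diffAt (E := E) (E' := E) (extChartAt 𝓘(ℝ, E) x₀) ((extChartAt 𝓘(ℝ, E) x₀).symm y) ∘L
      diffAt (E := E) (E' := E) (extChartAt 𝓘(ℝ, E) x₀).symm y = .id ℝ E := by
  rw [← diffAt_comp
    ((contMDiffAt_extChartAt_of_mem ((extChartAt 𝓘(ℝ, E) x₀).map_target hy)).mdifferentiableAt
      (by simp)) ((contMDiffAt_extChartAt_symm hy).mdifferentiableAt (by simp)),
    diffAt_congr (g := id), diffAt_id]
  filter_upwards [(isOpen_extChartAt_target x₀).mem_nhds hy] with z hz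
  exact (extChartAt 𝓘(ℝ, E) x₀).right_inv hz

theorem diffAt_symm_comp_extChartAt {x₀ : M} {y : E}
    (hy : y ∈ (extChartAt 𝓘(ℝ, E) x₀).target) :
    diffAt (E := E) (E' := E) (extChartAt 𝓘(ℝ, E) x₀).symm y ∘L
      diffAt (E := E) (E' := E) (extChartAt 𝓘(ℝ, E) x₀) ((extChartAt 𝓘(ℝ, E) x₀).symm y) =
        .id ℝ E := by
  have hs := (extChartAt 𝓘(ℝ, E) x₀).map_target hy
  have h := diffAt_comp (f := extChartAt 𝓘(ℝ, E) x₀) (g := (extChartAt 𝓘(ℝ, E) x₀).symm)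
    (x := (extChartAt 𝓘(ℝ, E) x₀).symm y) (E := E) (F := E) (F' := E)
    (by
      rw [(extChartAt 𝓘(ℝ, E) x₀).right_inv hy]
      exact (contMDiffAt_extChartAt_symm hy).mdifferentiableAt (by simp))
    ((contMDiffAt_extChartAt_of_mem hs).mdifferentiableAt (by simp))
  rw [(extChartAt 𝓘(ℝ, E) x₀).right_inv hy] at h
  rw [← h, diffAt_congr (g := id), diffAt_id]
  filter_upwards [(isOpen_extChartAt_source x₀).mem_nhds hs] with z hz
  exact (extChartAt 𝓘(ℝ, E) x₀).left_inv hz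

/-- The tangent space at `x` is identified with `E` through the preferred chart at `x` itself, so
this chart has identity differential there. Consequently `formFromChart` is the identity, and at the
base point `extD` and `lieD` are given by the plain coordinate formulas. -/
theorem diffAt_extChartAt_self (x : M) :
    diffAt (E := E) (E' := E) (extChartAt 𝓘(ℝ, E) x) x = .id ℝ E :=
  have : IsManifold 𝓘(ℝ, E) 1 M := .of_le (n := ∞) (by simp)
  mfderiv_extChartAt_self

theorem diffAt_extChartAt_symm_self (x : M) :
    diffAt (E := E) (E' := E) (extChartAt 𝓘(ℝ, E) x).symm (extChartAt 𝓘(ℝ, E) x x) =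
      .id ℝ E := by
  have h := diffAt_extChartAt_comp_symm (mem_extChartAt_target (I := 𝓘(ℝ, E)) x)
  rw [extChartAt_to_inv, diffAt_extChartAt_self] at h
  exact h

theorem formFromChart_eq {k : ℕ} (x : M) (α : E [⋀^Fin k]→L[ℝ] ℝ) : formFromChart x α = α := by
  change α.compContinuousLinearMap (diffAt (E := E) (E' := E) (extChartAt 𝓘(ℝ, E) x) x) = α
  rw [diffAt_extChartAt_self]
  rfl

theorem formAt_extD {k : ℕ} (Ω : FormField E M k) (x : M) :
    formAt (extD Ω) x = extDeriv (formInChart Ω x) (extChartAt 𝓘(ℝ, E) x x) :=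
  formFromChart_eq x _

theorem formAt_lieD {k : ℕ} (v : VecField E M) (Ω : FormField E M k) (x : M) :
    formAt (lieD v Ω) x =
      lieDerivModel (vecInChart v x) (formInChart Ω x) (extChartAt 𝓘(ℝ, E) x x) :=
  formFromChart_eq x _

theorem formInChart_self {k : ℕ} (Ω : FormField E M k) (x : M) :
    formInChart Ω x (extChartAt 𝓘(ℝ, E) x x) = formAt Ω x := by
  rw [formInChart, diffAt_extChartAt_symm_self, extChartAt_to_inv]
  rfl

/-- The chain rule for the two factorizations `f ∘ φ₀⁻¹ = φ₁⁻¹ ∘ (φ₁ ∘ f ∘ φ₀⁻¹)`. It translates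
differentials on manifolds into Fréchet derivatives of coordinate expressions. -/
theorem diffAt_comp_symm {f : M → N} {x₀ : M} {y : E}
    (hy : y ∈ (extChartAt 𝓘(ℝ, E) x₀).target)
    (hf : MDifferentiableAt 𝓘(ℝ, E) 𝓘(ℝ, F) f ((extChartAt 𝓘(ℝ, E) x₀).symm y))
    {x₁ : N} (h₁ : f ((extChartAt 𝓘(ℝ, E) x₀).symm y) ∈ (extChartAt 𝓘(ℝ, F) x₁).source) :
    diffAt (E := E) (E' := F) f ((extChartAt 𝓘(ℝ, E) x₀).symm y) ∘L
        diffAt (E := E) (E' := E) (extChartAt 𝓘(ℝ, E) x₀).symm y =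
      diffAt (E := F) (E' := F) (extChartAt 𝓘(ℝ, F) x₁).symm (mapInCharts f x₀ x₁ y) ∘L
        fderiv ℝ (mapInCharts f x₀ x₁) y := by
  have hsymm := (contMDiffAt_extChartAt_symm hy).mdifferentiableAt (by simp)
  rw [← diffAt_eq_fderiv, mapInCharts,
    diffAt_comp (f := f ∘ (extChartAt 𝓘(ℝ, E) x₀).symm) (E := E) (F := F) (F' := F)
      ((contMDiffAt_extChartAt_of_mem h₁).mdifferentiableAt (by simp)) (hf.comp y hsymm),
    diffAt_comp (E := E) (F := E) (F' := F) hf hsymm, ← ContinuousLinearMap.comp_assoc]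
  have h := diffAt_symm_comp_extChartAt ((extChartAt 𝓘(ℝ, F) x₁).map_source h₁)
  rw [(extChartAt 𝓘(ℝ, F) x₁).left_inv h₁] at h
  simp only [Function.comp_apply]
  rw [h, ContinuousLinearMap.id_comp]

/-- The coordinate expression of the pullback of a form. -/
theorem formInChart_pullbackForm {k : ℕ} {f : M → M} {x₀ x₁ : M} {y : E}
    (hy : y ∈ (extChartAt 𝓘(ℝ, E) x₀).target)
    (hf : MDifferentiableAt 𝓘(ℝ, E) 𝓘(ℝ, E) f ((extChartAt 𝓘(ℝ, E) x₀).symm y))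
    (h₁ : f ((extChartAt 𝓘(ℝ, E) x₀).symm y) ∈ (extChartAt 𝓘(ℝ, E) x₁).source)
    (Ω : FormField E M k) :
    formInChart (pullbackForm f Ω) x₀ y =
      (formInChart Ω x₁ (mapInCharts f x₀ x₁ y)).compContinuousLinearMap
        (fderiv ℝ (mapInCharts f x₀ x₁) y) := by
  have h := diffAt_comp_symm hy hf h₁
  have h2 : (extChartAt 𝓘(ℝ, E) x₁).symm (mapInCharts f x₀ x₁ y) =
      f ((extChartAt 𝓘(ℝ, E) x₀).symm y) := (extChartAt 𝓘(ℝ, E) x₁).left_inv h₁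
  rw [formInChart, pullbackForm_eq, formInChart, h2]
  ext w
  have h3 := fun i => congrArg (fun L : E →L[ℝ] E => L (w i)) h
  simp only [ContinuousAlternatingMap.compContinuousLinearMap_apply] at h3 ⊢
  exact congrArg _ (funext h3)

theorem contDiffAt_mapInCharts {f : M → N} {x₀ : M} {y : E}
    (hy : y ∈ (extChartAt 𝓘(ℝ, E) x₀).target)
    (hf : ContMDiffAt 𝓘(ℝ, E) 𝓘(ℝ, F) ∞ f ((extChartAt 𝓘(ℝ, E) x₀).symm y))
    {x₁ : N} (h₁ : f ((extChartAt 𝓘(ℝ, E) x₀).symm y) ∈ (extChartAt 𝓘(ℝ, F) x₁).source) :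
    ContDiffAt ℝ ∞ (mapInCharts (E := E) (F := F) f x₀ x₁) y :=
  contMDiffAt_iff_contDiffAt.1
    ((contMDiffAt_extChartAt_of_mem h₁).comp y (hf.comp y (contMDiffAt_extChartAt_symm hy)))

/-- The exterior derivative commutes with pullback. -/
theorem extD_pullbackForm {k : ℕ} {f : M → M} (hf : ContMDiff 𝓘(ℝ, E) 𝓘(ℝ, E) ∞ f)
    {Ω : FormField E M k} (hΩ : IsSmoothForm Ω) :
    extD (pullbackForm f Ω) = pullbackForm f (extD Ω) := by
  funext x
  change formAt (extD (pullbackForm f Ω)) x = formAt (pullbackForm f (extD Ω)) x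
  have hy := mem_extChartAt_target (I := 𝓘(ℝ, E)) x
  have hx : (extChartAt 𝓘(ℝ, E) x).symm (extChartAt 𝓘(ℝ, E) x x) = x := extChartAt_to_inv x
  have h₁ : f ((extChartAt 𝓘(ℝ, E) x).symm (extChartAt 𝓘(ℝ, E) x x)) ∈
      (extChartAt 𝓘(ℝ, E) (f x)).source := by
    rw [hx]
    exact mem_extChartAt_source (f x)
  have hv : mapInCharts f x (f x) (extChartAt 𝓘(ℝ, E) x x) = extChartAt 𝓘(ℝ, E) (f x) (f x) := by
    simp only [mapInCharts, Function.comp_apply, hx]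
  have hev : formInChart (pullbackForm f Ω) x =ᶠ[𝓝 (extChartAt 𝓘(ℝ, E) x x)]
      fun y => (formInChart Ω (f x) (mapInCharts f x (f x) y)).compContinuousLinearMap
        (fderiv ℝ (mapInCharts f x (f x)) y) := by
    filter_upwards [eventually_mem_source hy hf.continuous.continuousAt h₁] with z hz
    exact formInChart_pullbackForm hz.1 (hf.mdifferentiable (by simp) _) hz.2 Ω
  -- Naturality of the exterior derivative on normed spaces, applied to the coordinate expression of
  -- `f` in the charts at `x` and `f x`.
  rw [formAt_extD, hev.extDeriv_eq, extDeriv_pullback (r := ∞) (by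
      rw [hv]; exact hΩ.differentiableAt (f x)) (contDiffAt_mapInCharts hy (hf _) h₁)
      (by simp; norm_cast), pullbackForm_eq, formAt_extD, hv]
  -- At the base points both inverse charts have identity differential, so the differential of `f`
  -- at `x` is the Fréchet derivative of its coordinate expression.
  have h := diffAt_comp_symm hy (hf.mdifferentiable (by simp) _) h₁
  rw [hv, diffAt_extChartAt_symm_self, diffAt_extChartAt_symm_self, hx] at h
  have h' : diffAt (E := E) (E' := E) f x =
    fderiv ℝ (mapInCharts f x (f x)) (extChartAt 𝓘(ℝ, E) x x) := h
  rw [h']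

/-! ### Contraction with a vector field and Cartan's formula on a manifold. -/

section Contraction

/-- `vecInChart` applies the inverse of the differential of the inverse chart, which is a true
inverse only where that differential is invertible; on the chart target it is. -/
theorem vecInChart_eq (v : VecField E M) {x₀ : M} {y : E}
    (hy : y ∈ (extChartAt 𝓘(ℝ, E) x₀).target) :
    diffAt (E := E) (E' := E) (extChartAt 𝓘(ℝ, E) x₀).symm y (vecInChart v x₀ y) =
      vecAt v ((extChartAt 𝓘(ℝ, E) x₀).symm y) := by
  have hinv : (diffAt (E := E) (E' := E) (extChartAt 𝓘(ℝ, E) x₀).symm y).IsInvertible :=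
    .of_inverse (diffAt_symm_comp_extChartAt hy) (diffAt_extChartAt_comp_symm hy)
  exact hinv.self_apply_inverse _

theorem formInChart_contract {k : ℕ} (v : VecField E M) (Ω : FormField E M (k + 1)) {x₀ : M}
    {y : E} (hy : y ∈ (extChartAt 𝓘(ℝ, E) x₀).target) :
    formInChart (contract v Ω) x₀ y = (formInChart Ω x₀ y).curryLeft (vecInChart v x₀ y) := by
  ext w
  have h : formAt (contract v Ω) ((extChartAt 𝓘(ℝ, E) x₀).symm y) =
    (formAt Ω ((extChartAt 𝓘(ℝ, E) x₀).symm y)).curryLeft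
      (vecAt v ((extChartAt 𝓘(ℝ, E) x₀).symm y)) := rfl
  rw [formInChart, h, ← vecInChart_eq v hy, formInChart]
  simp only [ContinuousAlternatingMap.compContinuousLinearMap_apply,
    ContinuousAlternatingMap.curryLeft_apply_apply]
  congr 1
  funext i
  refine Fin.cases ?_ (fun j => ?_) i <;> simp

theorem contDiffAt_vecInChart [CompleteSpace E] {v : VecField E M} (hv : IsSmoothVecField v)
    {x₀ : M} {y : E} (hy : y ∈ (extChartAt 𝓘(ℝ, E) x₀).target) :
    ContDiffAt ℝ ∞ (vecInChart v x₀) y := by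
  have hinv : (diffAt (E := E) (E' := E) (extChartAt 𝓘(ℝ, E) x₀).symm y).IsInvertible :=
    .of_inverse (diffAt_symm_comp_extChartAt hy) (diffAt_extChartAt_comp_symm hy)
  have h := ContMDiffAt.mpullback_vectorField_preimage (m := ∞) (n := ∞)
    (hv ((extChartAt 𝓘(ℝ, E) x₀).symm y)) (contMDiffAt_extChartAt_symm hy) hinv (by simp)
  exact contMDiffAt_vectorSpace_iff_contDiffAt.1 h

theorem isSmoothForm_contract [CompleteSpace E] {k : ℕ} {v : VecField E M}
    (hv : IsSmoothVecField v) {Ω : FormField E M (k + 1)} (hΩ : IsSmoothForm Ω) :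
    IsSmoothForm (contract v Ω) := by
  intro x₀
  refine ContDiffOn.congr (f := fun y => (formInChart Ω x₀ y).curryLeft (vecInChart v x₀ y)) ?_
    fun y hy => formInChart_contract v Ω hy
  refine ContDiffOn.clm_apply ?_ fun y hy => (contDiffAt_vecInChart hv hy).contDiffWithinAt
  exact (curryLeftCLM E k).contDiff.comp_contDiffOn (hΩ x₀)

/-- Cartan's formula. -/
theorem lieD_eq_extD_add [CompleteSpace E] {k : ℕ} {v : VecField E M}
    (hv : IsSmoothVecField v) {Ω : FormField E M (k + 1)} (hΩ : IsSmoothForm Ω) :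
    lieD v Ω = extD (contract v Ω) + contract v (extD Ω) := by
  funext x
  change formAt (lieD v Ω) x = formAt (extD (contract v Ω)) x +
    (formAt (extD Ω) x).curryLeft (vecAt v x)
  have hy := mem_extChartAt_target (I := 𝓘(ℝ, E)) x
  have hev : formInChart (contract v Ω) x =ᶠ[𝓝 (extChartAt 𝓘(ℝ, E) x x)]
      fun y => (formInChart Ω x y).curryLeft (vecInChart v x y) := by
    filter_upwards [(isOpen_extChartAt_target x).mem_nhds hy] with y hy
    exact formInChart_contract v Ω hy
  have hvx := vecInChart_eq v hy
  rw [diffAt_extChartAt_symm_self, extChartAt_to_inv] at hvx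
  rw [formAt_lieD, formAt_extD, formAt_extD, hev.extDeriv_eq, ← hvx]
  exact lieDerivModel_eq_extDeriv_add ((contDiffAt_vecInChart hv hy).differentiableAt (by simp))
    (hΩ.differentiableAt x)

end Contraction

end Charts

/-! ### Joint smoothness of the family of pullbacks in the point and the group element. -/

section Averaging

set_option maxSynthPendingDepth 3

/-- Each partial differentiation of a jointly smooth function leaves a jointly smooth function. This
yields the joint continuity required by `contDiffOn_integral`. -/
theorem contDiffAt_iteratedFDeriv_partial {E F V : Type*} [NormedAddCommGroup E]
    [NormedSpace ℝ E] [NormedAddCommGroup F] [NormedSpace ℝ F] [NormedAddCommGroup V]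
    [NormedSpace ℝ V] {f : E × F → V} {p : E × F} (hf : ContDiffAt ℝ ∞ f p) (m : ℕ) :
    ContDiffAt ℝ ∞ (fun q : E × F => iteratedFDeriv ℝ m (fun y => f (y, q.2)) q.1) p := by
  induction m with
  | zero =>
    have : ContDiff ℝ ∞ (continuousMultilinearCurryFin0 ℝ E V).symm :=
      (continuousMultilinearCurryFin0 ℝ E V).symm.contDiff
    exact this.contDiffAt.comp p hf
  | succ m ih =>
    have h1 : ContDiffAt ℝ ∞ (fun q : E × F =>
        fderiv ℝ (iteratedFDeriv ℝ m (fun y => f (y, q.2))) q.1) p := by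
      refine ContDiffAt.fderiv (n := ∞)
        (f := fun (q : E × F) y => iteratedFDeriv ℝ m (fun y => f (y, q.2)) y) ?_
        contDiffAt_fst (by simp)
      exact ContDiffAt.comp (g := fun q : E × F => iteratedFDeriv ℝ m (fun y => f (y, q.2)) q.1)
        (f := fun r : (E × F) × E => (r.2, r.1.2)) (p, p.1) ih (by fun_prop)
    have h2 : ContDiff ℝ ∞ (continuousMultilinearCurryLeftEquiv ℝ
        (fun _ : Fin (m + 1) => E) V).symm :=
      (continuousMultilinearCurryLeftEquiv ℝ (fun _ : Fin (m + 1) => E) V).symm.contDiff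
    exact h2.contDiffAt.comp p h1

variable {E : Type*} [NormedAddCommGroup E] [NormedSpace ℝ E]
  {M : Type*} [TopologicalSpace M] [ChartedSpace E M]
  {F : Type*} [NormedAddCommGroup F] [NormedSpace ℝ F]
  {G : Type*} [TopologicalSpace G] [ChartedSpace F G]

/-- The partial derivatives of a function on `E × G` whose expressions in the charts of `G` are
smooth are jointly continuous. -/
theorem continuousAt_iteratedFDeriv_partial {V : Type*} [NormedAddCommGroup V] [NormedSpace ℝ V]
    {K : E → G → V} {y : E} {g : G}
    (hK : ContDiffAt ℝ ∞ (fun p : E × F => K p.1 ((extChartAt 𝓘(ℝ, F) g).symm p.2))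
      (y, extChartAt 𝓘(ℝ, F) g g)) (m : ℕ) :
    ContinuousAt (fun p : E × G => iteratedFDeriv ℝ m (fun z => K z p.2) p.1) (y, g) := by
  have h1 := (contDiffAt_iteratedFDeriv_partial hK m).continuousAt
  have h2 : ContinuousAt (fun p : E × G => (p.1, extChartAt 𝓘(ℝ, F) g p.2)) (y, g) :=
    continuousAt_fst.prodMk ((continuousAt_extChartAt g).comp (x := (y, g)) continuousAt_snd)
  refine (ContinuousAt.comp (x := (y, g)) (f := fun p : E × G => (p.1, extChartAt 𝓘(ℝ, F) g p.2))
    h1 h2).congr ?_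
  filter_upwards [continuousAt_snd (p := (y, g)) |>.eventually
    ((isOpen_extChartAt_source (I := 𝓘(ℝ, F)) g).mem_nhds (mem_extChartAt_source g))] with p hp
  -- Only the `E` variable is differentiated, so the chart of `G` merely reparametrizes `g` and
  -- cancels against its inverse near `g`.
  simp only [Function.comp_apply, (extChartAt 𝓘(ℝ, F) g).left_inv hp]

variable {θ : M × G → M}

theorem contMDiff_act (hθ : ContMDiff (𝓘(ℝ, E).prod 𝓘(ℝ, F)) 𝓘(ℝ, E) ∞ θ) (g : G) :
    ContMDiff 𝓘(ℝ, E) 𝓘(ℝ, E) ∞ (fun x => θ (x, g)) :=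
  hθ.comp (contMDiff_id.prodMk contMDiff_const)

theorem contMDiff_orbit (hθ : ContMDiff (𝓘(ℝ, E).prod 𝓘(ℝ, F)) 𝓘(ℝ, E) ∞ θ) (x : M) :
    ContMDiff 𝓘(ℝ, F) 𝓘(ℝ, E) ∞ (fun g => θ (x, g)) :=
  hθ.comp (contMDiff_const.prodMk contMDiff_id)

/-- The expression of a family of maps `θ (·, g)` in charts. -/
def familyInCharts (θ : M × G → M) (x₀ : M) (g₀ : G) (x₁ : M) (p : E × F) : E :=
  extChartAt 𝓘(ℝ, E) x₁
    (θ ((extChartAt 𝓘(ℝ, E) x₀).symm p.1, (extChartAt 𝓘(ℝ, F) g₀).symm p.2))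

variable [IsManifold 𝓘(ℝ, E) ∞ M] [IsManifold 𝓘(ℝ, F) ∞ G]

theorem contMDiffAt_family_symm (hθ : ContMDiff (𝓘(ℝ, E).prod 𝓘(ℝ, F)) 𝓘(ℝ, E) ∞ θ)
    {x₀ : M} {g₀ : G} {y : E} {z : F} (hy : y ∈ (extChartAt 𝓘(ℝ, E) x₀).target)
    (hz : z ∈ (extChartAt 𝓘(ℝ, F) g₀).target) :
    ContMDiffAt 𝓘(ℝ, E × F) 𝓘(ℝ, E) ∞ (fun p : E × F =>
      θ ((extChartAt 𝓘(ℝ, E) x₀).symm p.1, (extChartAt 𝓘(ℝ, F) g₀).symm p.2)) (y, z) := by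
  have h1 : ContMDiffAt 𝓘(ℝ, E × F) 𝓘(ℝ, E) ∞ (fun p : E × F =>
      (extChartAt 𝓘(ℝ, E) x₀).symm p.1) (y, z) :=
    ContMDiffAt.comp (I' := 𝓘(ℝ, E)) (y, z) (contMDiffAt_extChartAt_symm hy)
      contDiff_fst.contMDiff.contMDiffAt
  have h2 : ContMDiffAt 𝓘(ℝ, E × F) 𝓘(ℝ, F) ∞ (fun p : E × F =>
      (extChartAt 𝓘(ℝ, F) g₀).symm p.2) (y, z) :=
    ContMDiffAt.comp (I' := 𝓘(ℝ, F)) (y, z) (contMDiffAt_extChartAt_symm hz)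
      contDiff_snd.contMDiff.contMDiffAt
  exact hθ.contMDiffAt.comp (y, z) (h1.prodMk h2)

theorem contDiffAt_familyInCharts (hθ : ContMDiff (𝓘(ℝ, E).prod 𝓘(ℝ, F)) 𝓘(ℝ, E) ∞ θ)
    {x₀ x₁ : M} {g₀ : G} {y : E} {z : F} (hy : y ∈ (extChartAt 𝓘(ℝ, E) x₀).target)
    (hz : z ∈ (extChartAt 𝓘(ℝ, F) g₀).target)
    (h₁ : θ ((extChartAt 𝓘(ℝ, E) x₀).symm y, (extChartAt 𝓘(ℝ, F) g₀).symm z) ∈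
      (extChartAt 𝓘(ℝ, E) x₁).source) :
    ContDiffAt ℝ ∞ (familyInCharts (E := E) (F := F) θ x₀ g₀ x₁) (y, z) :=
  contMDiffAt_iff_contDiffAt.1
    (ContMDiffAt.comp (y, z) (contMDiffAt_extChartAt_of_mem h₁) (contMDiffAt_family_symm hθ hy hz))

/-- The coordinate expression of `θ_g^* η` in the chart at `x₀` depends smoothly on `g`. -/
theorem contDiffAt_formInChart_pullbackForm
    (hθ : ContMDiff (𝓘(ℝ, E).prod 𝓘(ℝ, F)) 𝓘(ℝ, E) ∞ θ) {k : ℕ} {η : FormField E M k}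
    (hη : IsSmoothForm η) {x₀ : M} {y : E} (hy : y ∈ (extChartAt 𝓘(ℝ, E) x₀).target) (g : G) :
    ContDiffAt ℝ ∞ (fun p : E × F => formInChart
      (pullbackForm (fun x => θ (x, (extChartAt 𝓘(ℝ, F) g).symm p.2)) η) x₀ p.1)
      (y, extChartAt 𝓘(ℝ, F) g g) := by
  have hz := mem_extChartAt_target (I := 𝓘(ℝ, F)) g
  -- Centring the target chart at the image point ensures that the family stays in its source for
  -- nearby points and group elements.
  set x₁ := θ ((extChartAt 𝓘(ℝ, E) x₀).symm y, g)
  have hx₁' : θ ((extChartAt 𝓘(ℝ, E) x₀).symm y,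
      (extChartAt 𝓘(ℝ, F) g).symm (extChartAt 𝓘(ℝ, F) g g)) = x₁ := by rw [extChartAt_to_inv]
  have h₁ : θ ((extChartAt 𝓘(ℝ, E) x₀).symm y,
      (extChartAt 𝓘(ℝ, F) g).symm (extChartAt 𝓘(ℝ, F) g g)) ∈
        (extChartAt 𝓘(ℝ, E) x₁).source := by
    rw [hx₁']
    exact mem_extChartAt_source x₁
  have hΦ := contDiffAt_familyInCharts hθ hy hz h₁
  have hev : ∀ᶠ p : E × F in 𝓝 (y, extChartAt 𝓘(ℝ, F) g g),
      p.1 ∈ (extChartAt 𝓘(ℝ, E) x₀).target ∧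
      θ ((extChartAt 𝓘(ℝ, E) x₀).symm p.1, (extChartAt 𝓘(ℝ, F) g).symm p.2) ∈
        (extChartAt 𝓘(ℝ, E) x₁).source :=
    (continuousAt_fst.eventually ((isOpen_extChartAt_target x₀).mem_nhds hy)).and
      ((contMDiffAt_family_symm hθ hy hz).continuousAt.eventually
        ((isOpen_extChartAt_source x₁).mem_nhds h₁))
  have hform : ContDiffAt ℝ ∞ (formInChart η x₁)
      (familyInCharts θ x₀ g x₁ (y, extChartAt 𝓘(ℝ, F) g g)) :=
    (hη x₁).contDiffAt ((isOpen_extChartAt_target x₁).mem_nhds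
      ((extChartAt 𝓘(ℝ, E) x₁).map_source h₁))
  have hD : ContDiffAt ℝ ∞ (fun p : E × F =>
      fderiv ℝ (fun y => familyInCharts θ x₀ g x₁ (y, p.2)) p.1)
      (y, extChartAt 𝓘(ℝ, F) g g) := by
    refine ContDiffAt.fderiv (n := ∞)
      (f := fun (q : E × F) y => familyInCharts θ x₀ g x₁ (y, q.2)) ?_ contDiffAt_fst (by simp)
    exact ContDiffAt.comp (g := familyInCharts θ x₀ g x₁)
      (f := fun r : (E × F) × E => (r.2, r.1.2)) _ hΦ (by fun_prop)
  refine ((hform.comp _ hΦ).alternatingCompContinuousLinearMap hD).congr_of_eventuallyEq ?_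
  filter_upwards [hev] with p hp
  exact formInChart_pullbackForm hp.1 ((contMDiff_act hθ _).mdifferentiable (by simp) _) hp.2 η

theorem continuousOn_iteratedFDeriv_formInChart_pullbackForm
    (hθ : ContMDiff (𝓘(ℝ, E).prod 𝓘(ℝ, F)) 𝓘(ℝ, E) ∞ θ) {k : ℕ} {η : FormField E M k}
    (hη : IsSmoothForm η) (x₀ : M) (m : ℕ) :
    ContinuousOn (fun p : E × G => iteratedFDeriv ℝ m (fun y =>
      formInChart (pullbackForm (fun x => θ (x, p.2)) η) x₀ y) p.1)
      ((extChartAt 𝓘(ℝ, E) x₀).target ×ˢ univ) := fun p hp =>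
  (continuousAt_iteratedFDeriv_partial
    (K := fun y g => formInChart (pullbackForm (fun x => θ (x, g)) η) x₀ y)
    (contDiffAt_formInChart_pullbackForm hθ hη hp.1 p.2) m).continuousWithinAt

theorem continuousOn_formInChart_pullbackForm
    (hθ : ContMDiff (𝓘(ℝ, E).prod 𝓘(ℝ, F)) 𝓘(ℝ, E) ∞ θ) {k : ℕ} {η : FormField E M k}
    (hη : IsSmoothForm η) (x₀ : M) :
    ContinuousOn (fun p : E × G => formInChart (pullbackForm (fun x => θ (x, p.2)) η) x₀ p.1)
      ((extChartAt 𝓘(ℝ, E) x₀).target ×ˢ univ) :=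
  (continuousMultilinearCurryFin0 ℝ E (E [⋀^Fin k]→L[ℝ] ℝ)).continuous.comp_continuousOn
    (continuousOn_iteratedFDeriv_formInChart_pullbackForm hθ hη x₀ 0)

theorem continuousOn_fderiv_formInChart_pullbackForm
    (hθ : ContMDiff (𝓘(ℝ, E).prod 𝓘(ℝ, F)) 𝓘(ℝ, E) ∞ θ) {k : ℕ} {η : FormField E M k}
    (hη : IsSmoothForm η) (x₀ : M) :
    ContinuousOn (fun p : E × G =>
      fderiv ℝ (formInChart (pullbackForm (fun x => θ (x, p.2)) η) x₀) p.1)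
      ((extChartAt 𝓘(ℝ, E) x₀).target ×ˢ univ) := by
  have h := (continuousMultilinearCurryFin1 ℝ E (E [⋀^Fin k]→L[ℝ] ℝ)).continuous.comp_continuousOn
    (continuousOn_iteratedFDeriv_formInChart_pullbackForm hθ hη x₀ 1)
  refine h.congr fun p _ => ?_
  ext1 e
  simp [iteratedFDeriv_one_apply]

theorem isSmoothForm_pullbackForm {f : M → M} (hf : ContMDiff 𝓘(ℝ, E) 𝓘(ℝ, E) ∞ f)
    {k : ℕ} {η : FormField E M k} (hη : IsSmoothForm η) : IsSmoothForm (pullbackForm f η) := by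
  intro x₀ y hy
  have h₁ := mem_extChartAt_source (I := 𝓘(ℝ, E)) (f ((extChartAt 𝓘(ℝ, E) x₀).symm y))
  have hΦ := contDiffAt_mapInCharts hy (hf _) h₁
  have hform := (hη (f ((extChartAt 𝓘(ℝ, E) x₀).symm y))).contDiffAt
    ((isOpen_extChartAt_target _).mem_nhds ((extChartAt 𝓘(ℝ, E) _).map_source h₁))
  refine ContDiffAt.contDiffWithinAt (((ContDiffAt.comp y hform hΦ).alternatingCompContinuousLinearMap
    (hΦ.fderiv_right (m := ∞) (by simp))).congr_of_eventuallyEq ?_)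
  filter_upwards [eventually_mem_source hy hf.continuous.continuousAt h₁] with z hz
  exact formInChart_pullbackForm hz.1 (hf.mdifferentiable (by simp) _) hz.2 η

end Averaging

/-! ### The average of a form over a compact parameter space. -/

section AverageForm

set_option maxSynthPendingDepth 3

variable {E : Type*} [NormedAddCommGroup E] [NormedSpace ℝ E]
  {M : Type*} [TopologicalSpace M] [ChartedSpace E M]
  {F : Type*} [NormedAddCommGroup F] [NormedSpace ℝ F]
  {G : Type*} [TopologicalSpace G] [ChartedSpace F G] [MeasurableSpace G]

/-- The average of the pullbacks of a form over a family of maps. -/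
def averageForm (μ : Measure G) (θ : M × G → M) {k : ℕ} (η : FormField E M k) :
    FormField E M k := fun x =>
  (∫ g, formAt (pullbackForm (fun y => θ (y, g)) η) x ∂μ : E [⋀^Fin k]→L[ℝ] ℝ)

variable [IsManifold 𝓘(ℝ, E) ∞ M] [IsManifold 𝓘(ℝ, F) ∞ G]
  [CompactSpace G] [T2Space G] [BorelSpace G] {μ : Measure G}
  {θ : M × G → M} {k : ℕ} {η : FormField E M k}

theorem integrable_formAt_pullbackForm [IsFiniteMeasure μ]
    (hθ : ContMDiff (𝓘(ℝ, E).prod 𝓘(ℝ, F)) 𝓘(ℝ, E) ∞ θ)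
    (hη : IsSmoothForm η) (x : M) :
    Integrable (fun g => formAt (pullbackForm (fun y => θ (y, g)) η) x) μ := by
  have h := (continuousOn_formInChart_pullbackForm hθ hη x).continuous_slice
    (mem_extChartAt_target (I := 𝓘(ℝ, E)) x)
  simp only [formInChart_self] at h
  exact h.integrable_of_compactSpace

/-- For fixed `y`, passing to coordinates is a continuous linear map, so it commutes with the
integral. -/
theorem formInChart_averageForm [IsFiniteMeasure μ]
    (hθ : ContMDiff (𝓘(ℝ, E).prod 𝓘(ℝ, F)) 𝓘(ℝ, E) ∞ θ)
    (hη : IsSmoothForm η) (x₀ : M) (y : E) :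
    formInChart (averageForm μ θ η) x₀ y =
      ∫ g, formInChart (pullbackForm (fun x => θ (x, g)) η) x₀ y ∂μ :=
  ((ContinuousAlternatingMap.compContinuousLinearMapCLM
    (diffAt (E := E) (E' := E) (extChartAt 𝓘(ℝ, E) x₀).symm y)).integral_comp_comm
    (integrable_formAt_pullbackForm (μ := μ) hθ hη ((extChartAt 𝓘(ℝ, E) x₀).symm y))).symm

theorem isSmoothForm_averageForm [FiniteDimensional ℝ E] [IsFiniteMeasure μ]
    (hθ : ContMDiff (𝓘(ℝ, E).prod 𝓘(ℝ, F)) 𝓘(ℝ, E) ∞ θ)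
    (hη : IsSmoothForm η) : IsSmoothForm (averageForm μ θ η) := by
  intro x₀
  rw [funext (formInChart_averageForm hθ hη x₀)]
  exact contDiffOn_integral (isOpen_extChartAt_target x₀)
    (fun g => isSmoothForm_pullbackForm (contMDiff_act hθ g) hη x₀)
    (continuousOn_iteratedFDeriv_formInChart_pullbackForm hθ hη x₀)

/-- The exterior derivative is the alternatization, a continuous linear map, of the Fréchet
derivative. Both operations pass under the integral, and `d` then commutes with each pullback. -/
theorem formAt_extD_averageForm [FiniteDimensional ℝ E] [IsFiniteMeasure μ]
    (hθ : ContMDiff (𝓘(ℝ, E).prod 𝓘(ℝ, F)) 𝓘(ℝ, E) ∞ θ)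
    (hη : IsSmoothForm η) (x : M) :
    formAt (extD (averageForm μ θ η)) x =
      ∫ g, formAt (pullbackForm (fun y => θ (y, g)) (extD η)) x ∂μ := by
  have hx := mem_extChartAt_target (I := 𝓘(ℝ, E)) x
  have hfd := continuousOn_fderiv_formInChart_pullbackForm hθ hη x
  have h := hasFDerivAt_integral_of_continuousOn (μ := μ) (isOpen_extChartAt_target x)
    (K := fun y g => formInChart (pullbackForm (fun x => θ (x, g)) η) x y)
    (continuousOn_formInChart_pullbackForm hθ hη x) hfd
    (fun y hy g => (((isSmoothForm_pullbackForm (contMDiff_act hθ g) hη x).contDiffAt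
      ((isOpen_extChartAt_target x).mem_nhds hy)).differentiableAt (by simp)).hasFDerivAt) hx
  rw [formAt_extD, funext (formInChart_averageForm hθ hη x), extDeriv, h.fderiv,
    ← ContinuousAlternatingMap.alternatizeUncurryFinCLM_apply,
    ← ContinuousLinearMap.integral_comp_comm _
      (hfd.continuous_slice hx).integrable_of_compactSpace]
  refine integral_congr_ae (Eventually.of_forall fun g => ?_)
  change _ = formAt (pullbackForm (fun y => θ (y, g)) (extD η)) x
  rw [← extD_pullbackForm (contMDiff_act hθ g) hη, formAt_extD]
  rfl

/-- If `dη` is invariant, averaging does not change it. -/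
theorem extD_averageForm [FiniteDimensional ℝ E] [IsProbabilityMeasure μ]
    (hθ : ContMDiff (𝓘(ℝ, E).prod 𝓘(ℝ, F)) 𝓘(ℝ, E) ∞ θ)
    (hη : IsSmoothForm η) (hinv : IsInvariantForm θ (extD η)) :
    extD (averageForm μ θ η) = extD η := by
  funext x
  change formAt (extD (averageForm μ θ η)) x = formAt (extD η) x
  rw [formAt_extD_averageForm hθ hη]
  -- The integrand is now constant in `g`, and `μ` has total mass `1`.
  simp only [hinv _]
  simp

variable [Group G]

/-- For a right action `θ_g ∘ θ_h = θ_{hg}`, so pulling back by `θ_h` translates the integration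
variable on the left; this is why left invariance of `μ` is the relevant one. -/
theorem isInvariantForm_averageForm [IsFiniteMeasure μ] [MeasurableMul G] [μ.IsMulLeftInvariant]
    (hθ : IsSmoothRightAction E F θ) (hη : IsSmoothForm η) :
    IsInvariantForm θ (averageForm μ θ η) := by
  intro h
  funext x
  change (∫ g, formAt (pullbackForm (fun y => θ (y, g)) η) (θ (x, h)) ∂μ :
      E [⋀^Fin k]→L[ℝ] ℝ).compContinuousLinearMap
      (diffAt (E := E) (E' := E) (fun y => θ (y, h)) x) =
    ∫ g, formAt (pullbackForm (fun y => θ (y, g)) η) x ∂μ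
  rw [← ContinuousAlternatingMap.compContinuousLinearMapCLM_apply,
    ← ContinuousLinearMap.integral_comp_comm _
      (integrable_formAt_pullbackForm hθ.contMDiff hη _),
    ← integral_mul_left_eq_self (fun g => formAt (pullbackForm (fun y => θ (y, g)) η) x) h]
  refine integral_congr_ae (Eventually.of_forall fun g => ?_)
  have h1 : (fun y => θ (y, h * g)) = (fun y => θ (y, g)) ∘ fun y => θ (y, h) :=
    funext fun y => hθ.map_mul y h g
  have h2 := diffAt_comp (E := E) (F := E) (F' := E) (x := x) (g := fun y => θ (y, g))
    (f := fun y => θ (y, h))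
    ((contMDiff_act hθ.contMDiff g).mdifferentiable (by simp) _)
    ((contMDiff_act hθ.contMDiff h).mdifferentiable (by simp) _)
  simp only [pullbackForm_eq, h1, h2]
  rfl

end AverageForm

/-! ### From invariance under the group to vanishing Lie derivatives. -/

section Invariance

variable {E : Type*} [NormedAddCommGroup E] [NormedSpace ℝ E]
  {M : Type*} [TopologicalSpace M] [ChartedSpace E M] [IsManifold 𝓘(ℝ, E) ∞ M]
  {F : Type*} [NormedAddCommGroup F] [NormedSpace ℝ F]
  {G : Type*} [TopologicalSpace G] [ChartedSpace F G] [IsManifold 𝓘(ℝ, F) ∞ G] [Group G]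

/-- Invariant forms are strictly preserved. -/
theorem IsInvariantForm.isStrictlyPreserved {θ : M × G → M} (hθ : IsSmoothRightAction E F θ)
    {k : ℕ} {H : FormField E M k} (hH : IsSmoothForm H) (hinv : IsInvariantForm θ H) :
    IsStrictlyPreserved F θ H := by
  intro ξ
  funext x
  change formAt (lieD (generator θ ξ) H) x = 0
  have hy := mem_extChartAt_target (I := 𝓘(ℝ, E)) x
  have hz := mem_extChartAt_target (I := 𝓘(ℝ, F)) (1 : G)
  have h1 : (extChartAt 𝓘(ℝ, F) (1 : G)).symm (extChartAt 𝓘(ℝ, F) (1 : G) 1) = 1 :=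
    extChartAt_to_inv 1
  have h₁ : θ ((extChartAt 𝓘(ℝ, E) x).symm (extChartAt 𝓘(ℝ, E) x x),
      (extChartAt 𝓘(ℝ, F) (1 : G)).symm (extChartAt 𝓘(ℝ, F) (1 : G) 1)) ∈
        (extChartAt 𝓘(ℝ, E) x).source := by
    rw [h1, hθ.map_one, extChartAt_to_inv]
    exact mem_extChartAt_source x
  have hid : ∀ y ∈ (extChartAt 𝓘(ℝ, E) x).target,
      familyInCharts θ x 1 x (y, extChartAt 𝓘(ℝ, F) (1 : G) 1) = y := fun y hy => by
    simp only [familyInCharts, h1, hθ.map_one, (extChartAt 𝓘(ℝ, E) x).right_inv hy]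
  rw [formAt_lieD]
  -- The local family is the action read in the chart of `M` at `x`, on source and target alike, and
  -- the chart of `G` at `1`. The remaining goals are that it is the identity at `1`, that it
  -- preserves the form, and that its variation field is the generator.
  refine lieDerivModel_eq_zero_of_invariant (ξ := (ξ : F))
    (contDiffAt_familyInCharts hθ.contMDiff hy hz h₁) ?_ (hH.differentiableAt x) ?_ ?_
  · filter_upwards [(isOpen_extChartAt_target x).mem_nhds hy] with y hy
    exact hid y hy
  · have hc : ContinuousAt (fun z : F => θ ((extChartAt 𝓘(ℝ, E) x).symm (extChartAt 𝓘(ℝ, E) x x),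
        (extChartAt 𝓘(ℝ, F) (1 : G)).symm z)) (extChartAt 𝓘(ℝ, F) (1 : G) 1) :=
      ((contMDiff_orbit hθ.contMDiff _).continuous.continuousAt).comp
        (contMDiffAt_extChartAt_symm hz).continuousAt
    filter_upwards [hc.eventually ((isOpen_extChartAt_source x).mem_nhds h₁)] with z hz
    have h := formInChart_pullbackForm hy
      ((contMDiff_act hθ.contMDiff ((extChartAt 𝓘(ℝ, F) (1 : G)).symm z)).mdifferentiable
        (by simp) _) hz H
    rw [hinv] at h
    exact h.symm
  · filter_upwards [(isOpen_extChartAt_target x).mem_nhds hy] with y hy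
    have hm : θ ((extChartAt 𝓘(ℝ, E) x).symm y,
        (extChartAt 𝓘(ℝ, F) (1 : G)).symm (extChartAt 𝓘(ℝ, F) (1 : G) 1)) ∈
        (extChartAt 𝓘(ℝ, E) x).source := by
      rw [h1, hθ.map_one]
      exact (extChartAt 𝓘(ℝ, E) x).map_target hy
    have h := diffAt_comp_symm (f := fun g => θ ((extChartAt 𝓘(ℝ, E) x).symm y, g)) hz
      ((contMDiff_orbit hθ.contMDiff _).mdifferentiable (by simp) _) hm
    have hval : mapInCharts (fun g => θ ((extChartAt 𝓘(ℝ, E) x).symm y, g)) 1 x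
        (extChartAt 𝓘(ℝ, F) (1 : G) 1) = y := hid y hy
    rw [hval, diffAt_extChartAt_symm_self, h1] at h
    -- The coordinate expression of the generator and the variation field of the family have the
    -- same image under the differential of the inverse chart, which is injective.
    have h2 := vecInChart_eq (generator θ ξ) hy
    have h3 : diffAt (E := E) (E' := E) (extChartAt 𝓘(ℝ, E) x).symm y
        (vecInChart (generator θ ξ) x y) = diffAt (E := E) (E' := E) (extChartAt 𝓘(ℝ, E) x).symm y
        (fderiv ℝ (mapInCharts (fun g => θ ((extChartAt 𝓘(ℝ, E) x).symm y, g)) 1 x)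
          (extChartAt 𝓘(ℝ, F) (1 : G) 1) ξ) :=
      h2.trans (congrArg (fun L : F →L[ℝ] E => L ξ) h)
    have hinj : Function.Injective
        (diffAt (E := E) (E' := E) (extChartAt 𝓘(ℝ, E) x).symm y) :=
      Function.LeftInverse.injective
        (g := diffAt (E := E) (E' := E) (extChartAt 𝓘(ℝ, E) x)
          ((extChartAt 𝓘(ℝ, E) x).symm y))
        fun e => congrArg (fun L : E →L[ℝ] E => L e) (diffAt_extChartAt_comp_symm hy)
    exact hinj h3

end Invariance

/-! ### Construction of the invariant Hamiltonian form. -/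

section Hamiltonian

variable {E : Type*} [NormedAddCommGroup E] [NormedSpace ℝ E]
  {M : Type*} [TopologicalSpace M] [ChartedSpace E M]

/-- If `H^{k+1}(M) = 0`, then closed `(k+1)`-forms have primitives. -/
theorem exists_extD_eq_of_subsingleton {k : ℕ} (hH : Subsingleton (DeRhamCohomology E M (k + 1)))
    {α : FormField E M (k + 1)} (hα : IsSmoothForm α) (hd : extD α = 0) :
    ∃ η : FormField E M k, IsSmoothForm η ∧ extD η = α := by
  have hmem : (⟨α, hα, hd⟩ : closedForms E M (k + 1)) ∈
      (exactForms E M (k + 1)).submoduleOf (closedForms E M (k + 1)) :=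
    (Submodule.Quotient.mk_eq_zero _).1 (hH.elim _ _)
  exact hmem.2

/-- An invariant vector field preserving an invariant pre-plectic form has an invariant Hamiltonian
form, provided that the relevant cohomology vanishes. -/
theorem exists_invariant_hamiltonianForm [FiniteDimensional ℝ E] [IsManifold 𝓘(ℝ, E) ∞ M]
    {F : Type*} [NormedAddCommGroup F] [NormedSpace ℝ F]
    {G : Type*} [TopologicalSpace G] [T2Space G] [ChartedSpace F G] [Group G]
    [LieGroup 𝓘(ℝ, F) ∞ G] [CompactSpace G]
    {θ : M × G → M} (hθ : IsSmoothRightAction E F θ)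
    {k : ℕ} {Ω : FormField E M (k + 2)} (hΩ : IsInvariantForm θ Ω)
    {v : VecField E M} (hv : IsSmoothVecField v) (hvG : IsInvariantVecField θ v)
    (hvΩ : lieD v Ω = 0) (hH : Subsingleton (DeRhamCohomology E M (k + 1)))
    (hpre : IsPrePlectic Ω) :
    ∃ H : FormField E M k, IsHamiltonianVecField Ω H v ∧
      IsInvariantForm θ H ∧ IsStrictlyPreserved F θ H := by
  have : CompleteSpace E := FiniteDimensional.complete ℝ E
  -- Cartan's formula with `L_v Ω = 0` and `dΩ = 0`.
  have hclosed : extD (contract v Ω) = 0 := by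
    have h := lieD_eq_extD_add hv hpre.1
    rw [hvΩ, hpre.2] at h
    have h0 : contract v (0 : FormField E M (k + 3)) = 0 := rfl
    rw [h0, add_zero] at h
    exact h.symm
  have hinv : IsInvariantForm θ (contract v Ω) := fun g => by
    rw [pullbackForm_contract (hvG g), hΩ g]
  obtain ⟨η, hη, hηd⟩ := exists_extD_eq_of_subsingleton hH (isSmoothForm_contract hv hpre.1) hclosed
  borelize G
  have : IsTopologicalGroup G := topologicalGroup_of_lieGroup 𝓘(ℝ, F) ∞
  -- Haar measure normalised on the whole group, which is compact, hence a probability measure.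
  let μ : Measure G := Measure.haarMeasure ⊤
  have : IsProbabilityMeasure μ := ⟨Measure.haarMeasure_self⟩
  have hsm : IsSmoothForm (averageForm μ θ η) := isSmoothForm_averageForm hθ.contMDiff hη
  have hI : IsInvariantForm θ (averageForm μ θ η) := isInvariantForm_averageForm hθ hη
  have hd : extD (averageForm μ θ η) = contract v Ω := by
    rw [extD_averageForm hθ.contMDiff hη (by rwa [hηd]), hηd]
  -- The average is a primitive of `ι_v Ω`; the convention `dH = -ι_v Ω` requires its negative,
  -- written as a scalar multiple so that `extD_smul` applies.
  have hsm' : IsSmoothForm ((-1 : ℝ) • averageForm μ θ η) := fun x => (hsm x).const_smul (-1 : ℝ)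
  have hI' : IsInvariantForm θ ((-1 : ℝ) • averageForm μ θ η) := fun g =>
    congrArg (fun Ω => (-1 : ℝ) • Ω) (hI g)
  refine ⟨(-1 : ℝ) • averageForm μ θ η, ⟨hsm', hv, ?_⟩, hI', hI'.isStrictlyPreserved hθ hsm'⟩
  rw [extD_smul, hd]
  funext x
  exact neg_one_smul ℝ (formAt (contract v Ω) x)

end Hamiltonian

end Multisymplectic

end

open Multisymplectic in
/-- Here `n = k + 1`, so that `n ≥ 1`. -/
theorem mainTheorem11
    {E : Type*} [NormedAddCommGroup E] [NormedSpace ℝ E] [FiniteDimensional ℝ E]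
    {M : Type*} [TopologicalSpace M] [T2Space M] [SecondCountableTopology M]
    [ChartedSpace E M] [IsManifold 𝓘(ℝ, E) ∞ M]
    {F : Type*} [NormedAddCommGroup F] [NormedSpace ℝ F] [FiniteDimensional ℝ F]
    {G : Type*} [TopologicalSpace G] [T2Space G] [ChartedSpace F G] [Group G]
    [LieGroup 𝓘(ℝ, F) ∞ G] [CompactSpace G] [ConnectedSpace G]
    (θ : M × G → M) (hθ : IsSmoothRightAction E F θ)
    (k : ℕ) (Ω : FormField E M (k + 2)) (hΩ : IsInvariantForm θ Ω)
    (v : VecField E M) (hv : IsSmoothVecField v) (hvG : IsInvariantVecField θ v)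
    (hvΩ : lieD v Ω = 0)
    (hH : Subsingleton (DeRhamCohomology E M (k + 1))) :
    (IsPrePlectic Ω →
      ∃ H : FormField E M k, IsHamiltonianVecField Ω H v ∧
        IsInvariantForm θ H ∧ IsStrictlyPreserved F θ H) ∧
    (IsVolumeForm Ω →
      ∃ H : FormField E M k, IsHamiltonianVecField Ω H v ∧
        IsInvariantForm θ H ∧ IsStrictlyPreserved F θ H) := by

  refine ⟨exists_invariant_hamiltonianForm hθ hΩ hv hvG hvΩ hH, fun hvol =>
    exists_invariant_hamiltonianForm hθ hΩ hv hvG hvΩ hH ⟨hvol.2.1, ?_⟩⟩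
  -- A volume form is closed: `dΩ` has degree `k + 3`, while the dimension is `k + 2`.
  exact formField_eq_zero (by rw [hvol.1]; exact Nat.lt_succ_self _) _
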